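/- Let $\mathcal L$ be a first-order language. Consider the formulas of intuitionistic first-order logic over $\mathcal L$, built from prime formulas $\chi$ (the atomic formulas $R(t_1,\dots,t_k)$ and $\bot$) and $\top$ by $\wedge,\vee,\Rightarrow,\forall x,\exists x$, and identified up to renaming of bound variables. Natural deduction proofs are written as typed $\lambda$-terms; $=_{\beta\eta}$ is the least congruence on them that contains the $\beta$- and $\eta$-laws of all the connectives and quantifiers (the $\eta$-laws of $\bot,\vee,\exists$ being taken in their general form, which includes the commuting conversions). For a finite list $\Gamma$ of formulas, write $\Gamma\vdash\varphi\cong\psi$ if there are proofs $M:(\Gamma\vdash\varphi\Rightarrow\psi)$ and $N:(\Gamma\vdash\psi\Rightarrow\varphi)$ such that $$\lambda x.\,M(Nx)=_{\beta\eta}\lambda x.\,x\qquad\text{and}\qquad \lambda y.\,N(My)=_{\beta\eta}\lambda y.\,y .$$ Define the classes $\mathbf\Pi$ and $\mathbf\Sigma$ of formulas by simultaneous induction: $$\mathbf\Pi\ni\gamma ::= \forall\vec x_1(\gamma_1\Rightarrow\beta_1)\wedge\cdots\wedge\forall\vec x_n(\gamma_n\Rightarrow\beta_n)\qquad(n\ge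 0),$$ $$\mathbf\Sigma\ni\beta ::= \chi \;\mid\; \gamma_1\vee\cdots\vee\gamma_n\;(n\ge 2)\;\mid\;\exists x\,\gamma,$$ where $\gamma,\gamma_i\in\mathbf\Pi$, $\beta_i\in\mathbf\Sigma$, $\chi$ is prime, each $\forall\vec x_i$ is a finite, possibly empty, block of universal quantifiers, $\exists x$ is a single quantifier, conjunctions and disjunctions are bracketed to the right, and the empty conjunction is $\top$. **Theorem.** Every first-order formula $\varphi$ can be normalized to a formula $\mathrm{enf}(\varphi)$ such that $\mathrm{enf}(\varphi)\in\mathbf\Pi\cup\mathbf\Sigma$ and $\Gamma\vdash\varphi\cong\mathrm{enf}(\varphi)$ for every $\Gamma$. -/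

import Mathlib

namespace ExpLog

universe u v

/-! ## First-order formulas

Variables are de Bruijn indices, so that formulas are identified up to renaming of bound variables.
The individual terms are the terms of the first-order language `L` over the variables `0, 1, 2, …`.
-/

/-- First-order formulas of intuitionistic predicate logic over a language `L`: all the connectives
and quantifiers are primitive. In `all φ` and `ex φ` the index `0` of `φ` is bound. -/
inductive Fm (L : FirstOrder.Language.{u, v}) : Type (max u v)
  | rel {n : ℕ} (R : L.Relations n) (ts : Fin n → L.Term ℕ) : Fm L
  | bot : Fm L
  | top : Fm L
  | and (φ ψ : Fm L) : Fm L
  | or (φ ψ : Fm L) : Fm L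
  | imp (φ ψ : Fm L) : Fm L
  | all (φ : Fm L) : Fm L
  | ex (φ : Fm L) : Fm L

variable {L : FirstOrder.Language.{u, v}}

/-- The stream `a, s 0, s 1, …`. -/
def scons {α : Type*} (a : α) (s : ℕ → α) : ℕ → α
  | 0 => a
  | i + 1 => s i

/-- The substitution of individual terms that renames every variable `i` to `i + 1`. -/
def shiftSub : ℕ → L.Term ℕ := fun i => FirstOrder.Language.Term.var (i + 1)

/-- The substitution that replaces the variable `0` by `t` and lowers the other variables. -/
def instSub (t : L.Term ℕ) : ℕ → L.Term ℕ := scons t FirstOrder.Language.Term.var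

/-- The substitution `σ`, moved under a binder for an individual variable. -/
def upSub (σ : ℕ → L.Term ℕ) : ℕ → L.Term ℕ :=
  scons (FirstOrder.Language.Term.var 0) (fun i => (σ i).subst shiftSub)

/-- Capture-avoiding simultaneous substitution in formulas. -/
def Fm.subst : Fm L → (ℕ → L.Term ℕ) → Fm L
  | .rel R ts, σ => .rel R (fun i => (ts i).subst σ)
  | .bot, _ => .bot
  | .top, _ => .top
  | .and φ ψ, σ => .and (φ.subst σ) (ψ.subst σ)
  | .or φ ψ, σ => .or (φ.subst σ) (ψ.subst σ)
  | .imp φ ψ, σ => .imp (φ.subst σ) (ψ.subst σ)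
  | .all φ, σ => .all (φ.subst (upSub σ))
  | .ex φ, σ => .ex (φ.subst (upSub σ))

/-- `φ` read under one more individual variable, which does not occur in it. -/
def Fm.shift (φ : Fm L) : Fm L := φ.subst shiftSub

/-- The instance `φ[t / x]` of the body `φ` of a quantified formula. -/
def Fm.inst (φ : Fm L) (t : L.Term ℕ) : Fm L := φ.subst (instSub t)

/-! ## Proof terms

Natural deduction proofs, written as terms of the typed lambda calculus. The variables for
hypotheses are de Bruijn indices too, independent of those for individuals. The terms
carry the formulas that make the type of a term unique in a given context.
-/

/-- Raw proof terms.
* `abort φ M` is ex falso quodlibet, with conclusion `φ`;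
* `inl ψ M` proves `φ ∨ ψ` from `M : φ`, and `inr φ M` proves `φ ∨ ψ` from `M : ψ`;
* `caseOf M P Q` binds a hypothesis in `P` and a hypothesis in `Q`;
* `lam φ M` binds a hypothesis `φ` in `M`;
* `gen M` binds an individual variable in `M`, and `spec M t` is the instance at `t`;
* `pack φ t M` proves `∃ x φ` from `M : φ[t / x]`;
* `unpack M P` binds an individual variable and a hypothesis in `P`. -/
inductive Pf (L : FirstOrder.Language.{u, v}) : Type (max u v)
  | var (i : ℕ) : Pf L
  | star : Pf L
  | abort (φ : Fm L) (M : Pf L) : Pf L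
  | pair (M N : Pf L) : Pf L
  | fst (M : Pf L) : Pf L
  | snd (M : Pf L) : Pf L
  | inl (ψ : Fm L) (M : Pf L) : Pf L
  | inr (φ : Fm L) (M : Pf L) : Pf L
  | caseOf (M P Q : Pf L) : Pf L
  | lam (φ : Fm L) (M : Pf L) : Pf L
  | app (M N : Pf L) : Pf L
  | gen (M : Pf L) : Pf L
  | spec (M : Pf L) (t : L.Term ℕ) : Pf L
  | pack (φ : Fm L) (t : L.Term ℕ) (M : Pf L) : Pf L
  | unpack (M P : Pf L) : Pf L

/-- Substitution of individual terms for individual variables in a proof term. -/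
def Pf.isubst : Pf L → (ℕ → L.Term ℕ) → Pf L
  | .var i, _ => .var i
  | .star, _ => .star
  | .abort φ M, σ => .abort (φ.subst σ) (M.isubst σ)
  | .pair M N, σ => .pair (M.isubst σ) (N.isubst σ)
  | .fst M, σ => .fst (M.isubst σ)
  | .snd M, σ => .snd (M.isubst σ)
  | .inl ψ M, σ => .inl (ψ.subst σ) (M.isubst σ)
  | .inr φ M, σ => .inr (φ.subst σ) (M.isubst σ)
  | .caseOf M P Q, σ => .caseOf (M.isubst σ) (P.isubst σ) (Q.isubst σ)
  | .lam φ M, σ => .lam (φ.subst σ) (M.isubst σ)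
  | .app M N, σ => .app (M.isubst σ) (N.isubst σ)
  | .gen M, σ => .gen (M.isubst (upSub σ))
  | .spec M t, σ => .spec (M.isubst σ) (t.subst σ)
  | .pack φ t M, σ => .pack (φ.subst (upSub σ)) (t.subst σ) (M.isubst σ)
  | .unpack M P, σ => .unpack (M.isubst σ) (P.isubst (upSub σ))

/-- The renaming `ρ`, moved under a binder for a hypothesis. -/
def upRen (ρ : ℕ → ℕ) : ℕ → ℕ := scons 0 (fun i => ρ i + 1)

/-- Renaming of the hypotheses in a proof term. -/
def Pf.rename : Pf L → (ℕ → ℕ) → Pf L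
  | .var i, ρ => .var (ρ i)
  | .star, _ => .star
  | .abort φ M, ρ => .abort φ (M.rename ρ)
  | .pair M N, ρ => .pair (M.rename ρ) (N.rename ρ)
  | .fst M, ρ => .fst (M.rename ρ)
  | .snd M, ρ => .snd (M.rename ρ)
  | .inl ψ M, ρ => .inl ψ (M.rename ρ)
  | .inr φ M, ρ => .inr φ (M.rename ρ)
  | .caseOf M P Q, ρ => .caseOf (M.rename ρ) (P.rename (upRen ρ)) (Q.rename (upRen ρ))
  | .lam φ M, ρ => .lam φ (M.rename (upRen ρ))
  | .app M N, ρ => .app (M.rename ρ) (N.rename ρ)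
  | .gen M, ρ => .gen (M.rename ρ)
  | .spec M t, ρ => .spec (M.rename ρ) t
  | .pack φ t M, ρ => .pack φ t (M.rename ρ)
  | .unpack M P, ρ => .unpack (M.rename ρ) (P.rename (upRen ρ))

/-- `M` read under one more hypothesis, which it does not use. -/
def Pf.weaken (M : Pf L) : Pf L := M.rename Nat.succ

/-- `M` read under one more individual variable, which does not occur in it. -/
def Pf.ishift (M : Pf L) : Pf L := M.isubst shiftSub

/-- The substitution `s` of proof terms for hypotheses, moved under a binder for a hypothesis. -/
def upPf (s : ℕ → Pf L) : ℕ → Pf L := scons (.var 0) (fun i => (s i).weaken)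

/-- Capture-avoiding simultaneous substitution of proof terms for hypotheses. -/
def Pf.subst : Pf L → (ℕ → Pf L) → Pf L
  | .var i, s => s i
  | .star, _ => .star
  | .abort φ M, s => .abort φ (M.subst s)
  | .pair M N, s => .pair (M.subst s) (N.subst s)
  | .fst M, s => .fst (M.subst s)
  | .snd M, s => .snd (M.subst s)
  | .inl ψ M, s => .inl ψ (M.subst s)
  | .inr φ M, s => .inr φ (M.subst s)
  | .caseOf M P Q, s => .caseOf (M.subst s) (P.subst (upPf s)) (Q.subst (upPf s))
  | .lam φ M, s => .lam φ (M.subst (upPf s))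
  | .app M N, s => .app (M.subst s) (N.subst s)
  | .gen M, s => .gen (M.subst (fun i => (s i).ishift))
  | .spec M t, s => .spec (M.subst s) t
  | .pack φ t M, s => .pack φ t (M.subst s)
  | .unpack M P, s => .unpack (M.subst s) (P.subst (upPf (fun i => (s i).ishift)))

/-- `M[N / x]`, for `x` the last hypothesis: that hypothesis is removed from the context. -/
def Pf.inst (M N : Pf L) : Pf L := M.subst (scons N Pf.var)

/-- `M[N / x]`, for `x` the last hypothesis, where `N` itself is a term in a context that
has another hypothesis in the place of `x`. -/
def Pf.instKeep (M N : Pf L) : Pf L := M.subst (scons N (fun i => Pf.var (i + 1)))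

/-- `Proves Γ M φ` is `M : (Γ ⊢ φ)` in intuitionistic natural deduction: `M` is a proof of `φ` from
the hypotheses in the list `Γ`. The eigenvariable conditions of `gen` and `unpack` are
expressed by shifting. -/
inductive Proves : List (Fm L) → Pf L → Fm L → Prop
  | var {Γ : List (Fm L)} {i : ℕ} {φ : Fm L} : Γ[i]? = some φ → Proves Γ (.var i) φ
  | star {Γ : List (Fm L)} : Proves Γ .star .top
  | abort {Γ : List (Fm L)} {M : Pf L} {φ : Fm L} :
      Proves Γ M .bot → Proves Γ (.abort φ M) φ
  | pair {Γ : List (Fm L)} {M N : Pf L} {φ ψ : Fm L} :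
      Proves Γ M φ → Proves Γ N ψ → Proves Γ (.pair M N) (.and φ ψ)
  | fst {Γ : List (Fm L)} {M : Pf L} {φ ψ : Fm L} :
      Proves Γ M (.and φ ψ) → Proves Γ (.fst M) φ
  | snd {Γ : List (Fm L)} {M : Pf L} {φ ψ : Fm L} :
      Proves Γ M (.and φ ψ) → Proves Γ (.snd M) ψ
  | inl {Γ : List (Fm L)} {M : Pf L} {φ ψ : Fm L} :
      Proves Γ M φ → Proves Γ (.inl ψ M) (.or φ ψ)
  | inr {Γ : List (Fm L)} {M : Pf L} {φ ψ : Fm L} :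
      Proves Γ M ψ → Proves Γ (.inr φ M) (.or φ ψ)
  | caseOf {Γ : List (Fm L)} {M P Q : Pf L} {φ ψ χ : Fm L} :
      Proves Γ M (.or φ ψ) → Proves (φ :: Γ) P χ → Proves (ψ :: Γ) Q χ →
      Proves Γ (.caseOf M P Q) χ
  | lam {Γ : List (Fm L)} {M : Pf L} {φ ψ : Fm L} :
      Proves (φ :: Γ) M ψ → Proves Γ (.lam φ M) (.imp φ ψ)
  | app {Γ : List (Fm L)} {M N : Pf L} {φ ψ : Fm L} :
      Proves Γ M (.imp φ ψ) → Proves Γ N φ → Proves Γ (.app M N) ψ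
  | gen {Γ : List (Fm L)} {M : Pf L} {φ : Fm L} :
      Proves (Γ.map Fm.shift) M φ → Proves Γ (.gen M) (.all φ)
  | spec {Γ : List (Fm L)} {M : Pf L} {φ : Fm L} (t : L.Term ℕ) :
      Proves Γ M (.all φ) → Proves Γ (.spec M t) (φ.inst t)
  | pack {Γ : List (Fm L)} {M : Pf L} {φ : Fm L} (t : L.Term ℕ) :
      Proves Γ M (φ.inst t) → Proves Γ (.pack φ t M) (.ex φ)
  | unpack {Γ : List (Fm L)} {M P : Pf L} {φ χ : Fm L} :
      Proves Γ M (.ex φ) → Proves (φ :: Γ.map Fm.shift) P χ.shift →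
      Proves Γ (.unpack M P) χ

/-- `BetaEta Γ M N φ` says that `M` and `N` are `βη`-equal proofs of `φ` from `Γ`: the least
congruence that contains the `β`- and `η`-laws of all the connectives and quantifiers. The
`η`-laws of `⊥`, `∨` and `∃` are stated for an arbitrary context `P` of the eliminated term, so
that they include the commuting conversions. -/
inductive BetaEta : List (Fm L) → Pf L → Pf L → Fm L → Prop
  -- equivalence relation
  | refl {Γ : List (Fm L)} {M : Pf L} {φ : Fm L} : Proves Γ M φ → BetaEta Γ M M φ
  | symm {Γ : List (Fm L)} {M N : Pf L} {φ : Fm L} : BetaEta Γ M N φ → BetaEta Γ N M φ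
  | trans {Γ : List (Fm L)} {M N P : Pf L} {φ : Fm L} :
      BetaEta Γ M N φ → BetaEta Γ N P φ → BetaEta Γ M P φ
  -- congruence
  | abort {Γ : List (Fm L)} {M M' : Pf L} {φ : Fm L} :
      BetaEta Γ M M' .bot → BetaEta Γ (.abort φ M) (.abort φ M') φ
  | pair {Γ : List (Fm L)} {M M' N N' : Pf L} {φ ψ : Fm L} :
      BetaEta Γ M M' φ → BetaEta Γ N N' ψ → BetaEta Γ (.pair M N) (.pair M' N') (.and φ ψ)
  | fst {Γ : List (Fm L)} {M M' : Pf L} {φ ψ : Fm L} :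
      BetaEta Γ M M' (.and φ ψ) → BetaEta Γ (.fst M) (.fst M') φ
  | snd {Γ : List (Fm L)} {M M' : Pf L} {φ ψ : Fm L} :
      BetaEta Γ M M' (.and φ ψ) → BetaEta Γ (.snd M) (.snd M') ψ
  | inl {Γ : List (Fm L)} {M M' : Pf L} {φ ψ : Fm L} :
      BetaEta Γ M M' φ → BetaEta Γ (.inl ψ M) (.inl ψ M') (.or φ ψ)
  | inr {Γ : List (Fm L)} {M M' : Pf L} {φ ψ : Fm L} :
      BetaEta Γ M M' ψ → BetaEta Γ (.inr φ M) (.inr φ M') (.or φ ψ)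
  | caseOf {Γ : List (Fm L)} {M M' P P' Q Q' : Pf L} {φ ψ χ : Fm L} :
      BetaEta Γ M M' (.or φ ψ) → BetaEta (φ :: Γ) P P' χ → BetaEta (ψ :: Γ) Q Q' χ →
      BetaEta Γ (.caseOf M P Q) (.caseOf M' P' Q') χ
  | lam {Γ : List (Fm L)} {M M' : Pf L} {φ ψ : Fm L} :
      BetaEta (φ :: Γ) M M' ψ → BetaEta Γ (.lam φ M) (.lam φ M') (.imp φ ψ)
  | app {Γ : List (Fm L)} {M M' N N' : Pf L} {φ ψ : Fm L} :
      BetaEta Γ M M' (.imp φ ψ) → BetaEta Γ N N' φ → BetaEta Γ (.app M N) (.app M' N') ψ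
  | gen {Γ : List (Fm L)} {M M' : Pf L} {φ : Fm L} :
      BetaEta (Γ.map Fm.shift) M M' φ → BetaEta Γ (.gen M) (.gen M') (.all φ)
  | spec {Γ : List (Fm L)} {M M' : Pf L} {φ : Fm L} (t : L.Term ℕ) :
      BetaEta Γ M M' (.all φ) → BetaEta Γ (.spec M t) (.spec M' t) (φ.inst t)
  | pack {Γ : List (Fm L)} {M M' : Pf L} {φ : Fm L} (t : L.Term ℕ) :
      BetaEta Γ M M' (φ.inst t) → BetaEta Γ (.pack φ t M) (.pack φ t M') (.ex φ)
  | unpack {Γ : List (Fm L)} {M M' P P' : Pf L} {φ χ : Fm L} :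
      BetaEta Γ M M' (.ex φ) → BetaEta (φ :: Γ.map Fm.shift) P P' χ.shift →
      BetaEta Γ (.unpack M P) (.unpack M' P') χ
  -- `β`-laws
  | beta_fst {Γ : List (Fm L)} {M N : Pf L} {φ ψ : Fm L} :
      Proves Γ M φ → Proves Γ N ψ → BetaEta Γ (.fst (.pair M N)) M φ
  | beta_snd {Γ : List (Fm L)} {M N : Pf L} {φ ψ : Fm L} :
      Proves Γ M φ → Proves Γ N ψ → BetaEta Γ (.snd (.pair M N)) N ψ
  | beta_inl {Γ : List (Fm L)} {M P Q : Pf L} {φ ψ χ : Fm L} :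
      Proves Γ M φ → Proves (φ :: Γ) P χ → Proves (ψ :: Γ) Q χ →
      BetaEta Γ (.caseOf (.inl ψ M) P Q) (P.inst M) χ
  | beta_inr {Γ : List (Fm L)} {M P Q : Pf L} {φ ψ χ : Fm L} :
      Proves Γ M ψ → Proves (φ :: Γ) P χ → Proves (ψ :: Γ) Q χ →
      BetaEta Γ (.caseOf (.inr φ M) P Q) (Q.inst M) χ
  | beta_imp {Γ : List (Fm L)} {M N : Pf L} {φ ψ : Fm L} :
      Proves (φ :: Γ) M ψ → Proves Γ N φ → BetaEta Γ (.app (.lam φ M) N) (M.inst N) ψ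
  | beta_all {Γ : List (Fm L)} {M : Pf L} {φ : Fm L} (t : L.Term ℕ) :
      Proves (Γ.map Fm.shift) M φ →
      BetaEta Γ (.spec (.gen M) t) (M.isubst (instSub t)) (φ.inst t)
  | beta_ex {Γ : List (Fm L)} {M P : Pf L} {φ χ : Fm L} (t : L.Term ℕ) :
      Proves Γ M (φ.inst t) → Proves (φ :: Γ.map Fm.shift) P χ.shift →
      BetaEta Γ (.unpack (.pack φ t M) P) ((P.isubst (instSub t)).inst M) χ
  -- `η`-laws
  | eta_top {Γ : List (Fm L)} {M : Pf L} : Proves Γ M .top → BetaEta Γ M .star .top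
  | eta_bot {Γ : List (Fm L)} {M P : Pf L} {χ : Fm L} :
      Proves Γ M .bot → Proves (.bot :: Γ) P χ → BetaEta Γ (P.inst M) (.abort χ M) χ
  | eta_and {Γ : List (Fm L)} {M : Pf L} {φ ψ : Fm L} :
      Proves Γ M (.and φ ψ) → BetaEta Γ M (.pair (.fst M) (.snd M)) (.and φ ψ)
  | eta_or {Γ : List (Fm L)} {M P : Pf L} {φ ψ χ : Fm L} :
      Proves Γ M (.or φ ψ) → Proves (.or φ ψ :: Γ) P χ →
      BetaEta Γ (P.inst M)
        (.caseOf M (P.instKeep (.inl ψ (.var 0))) (P.instKeep (.inr φ (.var 0)))) χ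
  | eta_imp {Γ : List (Fm L)} {M : Pf L} {φ ψ : Fm L} :
      Proves Γ M (.imp φ ψ) → BetaEta Γ M (.lam φ (.app M.weaken (.var 0))) (.imp φ ψ)
  | eta_all {Γ : List (Fm L)} {M : Pf L} {φ : Fm L} :
      Proves Γ M (.all φ) →
      BetaEta Γ M (.gen (.spec M.ishift (FirstOrder.Language.Term.var 0))) (.all φ)
  | eta_ex {Γ : List (Fm L)} {M P : Pf L} {φ χ : Fm L} :
      Proves Γ M (.ex φ) → Proves (.ex φ :: Γ) P χ →
      BetaEta Γ (P.inst M)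
        (.unpack M (P.ishift.instKeep
          (.pack (φ.subst (upSub shiftSub)) (FirstOrder.Language.Term.var 0) (.var 0)))) χ

/-- Isomorphism of formulas over a context `Γ`: there are proofs `M : (Γ ⊢ φ ⇒ ψ)` and
`N : (Γ ⊢ ψ ⇒ φ)` with `λ x. M (N x) = λ x. x` and `λ y. N (M y) = λ y. y` up to `βη`. -/
def Iso (Γ : List (Fm L)) (φ ψ : Fm L) : Prop :=
  ∃ M N : Pf L, Proves Γ M (.imp φ ψ) ∧ Proves Γ N (.imp ψ φ) ∧
    BetaEta Γ (.lam ψ (.app M.weaken (.app N.weaken (.var 0)))) (.lam ψ (.var 0)) (.imp ψ ψ) ∧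
    BetaEta Γ (.lam φ (.app N.weaken (.app M.weaken (.var 0)))) (.lam φ (.var 0)) (.imp φ φ)

/-! ## The normal forms -/

/-- Prime formulas: the atomic formulas and `⊥`. -/
inductive IsPrime : Fm L → Prop
  | rel {n : ℕ} (R : L.Relations n) (ts : Fin n → L.Term ℕ) : IsPrime (.rel R ts)
  | bot : IsPrime .bot

/-- The conjunction `φ₁ ∧ (φ₂ ∧ (⋯ ∧ φₙ))`; it is `⊤` for `n = 0` and `φ₁` for `n = 1`. -/
def conj : List (Fm L) → Fm L
  | [] => .top
  | [φ] => φ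
  | φ :: ψ :: l => .and φ (conj (ψ :: l))

/-- The disjunction `φ₁ ∨ (φ₂ ∨ (⋯ ∨ φₙ))`; it is `φ₁` for `n = 1`. -/
def disj : List (Fm L) → Fm L
  | [] => .bot
  | [φ] => φ
  | φ :: ψ :: l => .or φ (disj (ψ :: l))

/-- `k` universal quantifiers in front of `φ`. -/
def allBlock : ℕ → Fm L → Fm L
  | 0, φ => φ
  | k + 1, φ => .all (allBlock k φ)

/-- One factor of a `Π`-formula: the data of `∀ x₁ ⋯ ∀ xₖ (γ ⇒ β)`. -/
structure Factor (L : FirstOrder.Language.{u, v}) where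
  block : ℕ
  prem : Fm L
  concl : Fm L

/-- The formula `∀ x₁ ⋯ ∀ xₖ (γ ⇒ β)`. -/
def Factor.toFm (p : Factor L) : Fm L := allBlock p.block (.imp p.prem p.concl)

mutual

/-- The class `Π`. -/
inductive IsPi : Fm L → Prop
  | conj (l : List (Factor L)) :
      (∀ p ∈ l, IsPi p.prem) → (∀ p ∈ l, IsSigma p.concl) →
      IsPi (conj (l.map Factor.toFm))

/-- The class `Σ`. -/
inductive IsSigma : Fm L → Prop
  | prime {χ : Fm L} : IsPrime χ → IsSigma χ
  | disj (l : List (Fm L)) : 2 ≤ l.length → (∀ γ ∈ l, IsPi γ) → IsSigma (disj l)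
  | ex {γ : Fm L} : IsPi γ → IsSigma (.ex γ)

end

end ExpLog

namespace ExpLog

open FirstOrder.Language

universe u v

variable {L : FirstOrder.Language.{u, v}}

/-! ## Substitution of individual terms -/

theorem term_subst_subst (t : L.Term ℕ) (σ τ : ℕ → L.Term ℕ) :
    (t.subst σ).subst τ = t.subst (fun i => (σ i).subst τ) := by
  induction t with
  | var i => rfl
  | func f ts ih => simp only [Term.subst, ih]

theorem term_subst_var (t : L.Term ℕ) : t.subst Term.var = t := by
  induction t with
  | var i => rfl
  | func f ts ih => simp only [Term.subst, ih]

theorem upSub_var : upSub (L := L) Term.var = Term.var := by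
  funext i; cases i <;> rfl

theorem upSub_subst (σ τ : ℕ → L.Term ℕ) :
    (fun i => (upSub σ i).subst (upSub τ)) = upSub (fun i => (σ i).subst τ) := by
  funext i
  cases i with
  | zero => rfl
  | succ i => simp only [upSub, scons, term_subst_subst]; rfl

theorem Fm.subst_subst (φ : Fm L) (σ τ : ℕ → L.Term ℕ) :
    (φ.subst σ).subst τ = φ.subst (fun i => (σ i).subst τ) := by
  induction φ generalizing σ τ <;>
    simp_all only [Fm.subst, term_subst_subst, upSub_subst]

theorem Fm.subst_var (φ : Fm L) : φ.subst Term.var = φ := by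
  induction φ <;> simp_all only [Fm.subst, term_subst_var, upSub_var]

theorem Fm.shift_subst_upSub (φ : Fm L) (σ : ℕ → L.Term ℕ) :
    φ.shift.subst (upSub σ) = (φ.subst σ).shift := by
  simp only [Fm.shift, Fm.subst_subst]; rfl

theorem Fm.inst_subst (φ : Fm L) (t : L.Term ℕ) (σ : ℕ → L.Term ℕ) :
    (φ.inst t).subst σ = (φ.subst (upSub σ)).inst (t.subst σ) := by
  simp only [Fm.inst, Fm.subst_subst]
  congr 1
  funext i
  cases i with
  | zero => rfl
  | succ i => simp only [upSub, instSub, scons, term_subst_subst]; exact (term_subst_var _).symm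

theorem upSub_shiftSub_instSub :
    (fun i => (upSub (L := L) shiftSub i).subst (instSub (Term.var 0))) = Term.var := by
  funext i; cases i <;> rfl

theorem Fm.subst_upSub_shiftSub_inst (φ : Fm L) :
    (φ.subst (upSub shiftSub)).inst (Term.var 0) = φ := by
  rw [Fm.inst, Fm.subst_subst, upSub_shiftSub_instSub, Fm.subst_var]

theorem Pf.isubst_isubst (M : Pf L) (σ τ : ℕ → L.Term ℕ) :
    (M.isubst σ).isubst τ = M.isubst (fun i => (σ i).subst τ) := by
  induction M generalizing σ τ <;>
    simp_all only [Pf.isubst, Fm.subst_subst, term_subst_subst, upSub_subst]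

theorem Pf.isubst_var (M : Pf L) : M.isubst Term.var = M := by
  induction M <;> simp_all only [Pf.isubst, Fm.subst_var, term_subst_var, upSub_var]

theorem Pf.isubst_upSub_shiftSub_instSub (M : Pf L) :
    (M.isubst (upSub shiftSub)).isubst (instSub (Term.var 0)) = M := by
  rw [Pf.isubst_isubst, upSub_shiftSub_instSub, Pf.isubst_var]

/-! ## Typing -/

theorem map_shift_map_subst (Γ : List (Fm L)) (σ : ℕ → L.Term ℕ) :
    (Γ.map Fm.shift).map (fun φ => φ.subst (upSub σ)) =
      (Γ.map (fun φ => φ.subst σ)).map Fm.shift := by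
  simp only [List.map_map]
  exact List.map_congr_left fun φ _ => φ.shift_subst_upSub σ

theorem Proves.isubst {Γ : List (Fm L)} {M : Pf L} {φ : Fm L} (h : Proves Γ M φ)
    (σ : ℕ → L.Term ℕ) : Proves (Γ.map (fun φ => φ.subst σ)) (M.isubst σ) (φ.subst σ) := by
  induction h generalizing σ with
  | var h => exact .var (by simp [h])
  | star => exact .star
  | abort _ ih => exact .abort (ih σ)
  | pair _ _ ih₁ ih₂ => exact .pair (ih₁ σ) (ih₂ σ)
  | fst _ ih => exact .fst (ih σ)
  | snd _ ih => exact .snd (ih σ)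
  | inl _ ih => exact .inl (ih σ)
  | inr _ ih => exact .inr (ih σ)
  | caseOf _ _ _ ih ih₁ ih₂ => exact .caseOf (ih σ) (ih₁ σ) (ih₂ σ)
  | lam _ ih => exact .lam (ih σ)
  | app _ _ ih₁ ih₂ => exact .app (ih₁ σ) (ih₂ σ)
  | gen _ ih => exact .gen (by simpa only [map_shift_map_subst] using ih (upSub σ))
  | spec t _ ih => rw [Fm.inst_subst]; exact .spec _ (ih σ)
  | pack t _ ih => exact .pack _ (by simpa only [Fm.inst_subst] using ih σ)
  | unpack _ _ ih₁ ih₂ =>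
    refine .unpack (ih₁ σ) ?_
    simpa only [List.map_cons, map_shift_map_subst, Fm.shift_subst_upSub] using ih₂ (upSub σ)

theorem Proves.append {Γ : List (Fm L)} {M : Pf L} {φ : Fm L} (h : Proves Γ M φ)
    (Δ : List (Fm L)) : Proves (Γ ++ Δ) M φ := by
  induction h generalizing Δ with
  | var h => exact .var (by rw [List.getElem?_append_left (List.getElem?_eq_some_iff.1 h).1, h])
  | star => exact .star
  | abort _ ih => exact .abort (ih Δ)
  | pair _ _ ih₁ ih₂ => exact .pair (ih₁ Δ) (ih₂ Δ)
  | fst _ ih => exact .fst (ih Δ)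
  | snd _ ih => exact .snd (ih Δ)
  | inl _ ih => exact .inl (ih Δ)
  | inr _ ih => exact .inr (ih Δ)
  | caseOf _ _ _ ih ih₁ ih₂ => exact .caseOf (ih Δ) (ih₁ Δ) (ih₂ Δ)
  | lam _ ih => exact .lam (ih Δ)
  | app _ _ ih₁ ih₂ => exact .app (ih₁ Δ) (ih₂ Δ)
  | gen _ ih => exact .gen (by simpa only [List.map_append] using ih (Δ.map Fm.shift))
  | spec t _ ih => exact .spec _ (ih Δ)
  | pack t _ ih => exact .pack _ (ih Δ)
  | unpack _ _ ih₁ ih₂ =>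
    exact .unpack (ih₁ Δ) (by
      simpa only [List.map_append, List.cons_append] using ih₂ (Δ.map Fm.shift))

theorem upPf_eq_var {s : ℕ → Pf L} {n : ℕ} (hs : ∀ i < n, s i = .var i) :
    ∀ i < n + 1, upPf s i = .var i := by
  intro i hi
  cases i with
  | zero => rfl
  | succ i => simp only [upPf, scons, hs i (by omega)]; rfl

theorem ishift_eq_var {s : ℕ → Pf L} {n : ℕ} (hs : ∀ i < n, s i = .var i) :
    ∀ i < n, (s i).ishift = .var i := by
  intro i hi
  rw [hs i hi]; rfl

theorem upRen_eq_self {ρ : ℕ → ℕ} {n : ℕ} (hρ : ∀ i < n, ρ i = i) :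
    ∀ i < n + 1, upRen ρ i = i := by
  intro i hi
  cases i with
  | zero => rfl
  | succ i => simp only [upRen, scons, hρ i (by omega)]

theorem Proves.subst_eq_self {Γ : List (Fm L)} {M : Pf L} {φ : Fm L} (h : Proves Γ M φ)
    (s : ℕ → Pf L) (hs : ∀ i < Γ.length, s i = .var i) : M.subst s = M := by
  induction h generalizing s with
  | var h => exact hs _ (List.getElem?_eq_some_iff.1 h).1
  | star => rfl
  | caseOf _ _ _ ih ih₁ ih₂ =>
    simp only [Pf.subst, ih s hs, ih₁ _ (upPf_eq_var hs), ih₂ _ (upPf_eq_var hs)]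
  | lam _ ih => simp only [Pf.subst, ih _ (upPf_eq_var hs)]
  | gen _ ih =>
    simp only [Pf.subst, ih _ (by simpa only [List.length_map] using ishift_eq_var hs)]
  | unpack _ _ ih₁ ih₂ =>
    simp only [Pf.subst, ih₁ s hs, ih₂ _ (by
      simpa only [List.length_cons, List.length_map] using upPf_eq_var (ishift_eq_var hs))]
  | _ => simp only [Pf.subst]; grind only

theorem Proves.rename_eq_self {Γ : List (Fm L)} {M : Pf L} {φ : Fm L} (h : Proves Γ M φ)
    (ρ : ℕ → ℕ) (hρ : ∀ i < Γ.length, ρ i = i) : M.rename ρ = M := by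
  induction h generalizing ρ with
  | var h => exact congrArg Pf.var (hρ _ (List.getElem?_eq_some_iff.1 h).1)
  | star => rfl
  | caseOf _ _ _ ih ih₁ ih₂ =>
    simp only [Pf.rename, ih ρ hρ, ih₁ _ (upRen_eq_self hρ), ih₂ _ (upRen_eq_self hρ)]
  | lam _ ih => simp only [Pf.rename, ih _ (upRen_eq_self hρ)]
  | gen _ ih =>
    simp only [Pf.rename, ih ρ (by simpa only [List.length_map] using hρ)]
  | unpack _ _ ih₁ ih₂ =>
    simp only [Pf.rename, ih₁ ρ hρ, ih₂ _ (by
      simpa only [List.length_cons, List.length_map] using upRen_eq_self hρ)]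
  | _ => simp only [Pf.rename]; grind only

theorem Proves.closed_subst {M : Pf L} {φ : Fm L} (h : Proves [] M φ) (s : ℕ → Pf L) :
    M.subst s = M :=
  h.subst_eq_self s (by simp)

theorem Proves.closed_rename {M : Pf L} {φ : Fm L} (h : Proves [] M φ) (ρ : ℕ → ℕ) :
    M.rename ρ = M :=
  h.rename_eq_self ρ (by simp)

theorem Proves.of_closed {M : Pf L} {φ : Fm L} (h : Proves [] M φ) {Γ : List (Fm L)} :
    Proves Γ M φ :=
  h.append Γ

theorem Proves.spec_var {Γ : List (Fm L)} {M : Pf L} {φ : Fm L}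
    (h : Proves Γ M (.all (φ.subst (upSub shiftSub)))) : Proves Γ (.spec M (Term.var 0)) φ := by
  simpa only [Fm.subst_upSub_shiftSub_inst] using Proves.spec (Term.var 0) h

theorem BetaEta.spec_var {Γ : List (Fm L)} {M N : Pf L} {φ : Fm L}
    (h : BetaEta Γ M N (.all (φ.subst (upSub shiftSub)))) :
    BetaEta Γ (.spec M (Term.var 0)) (.spec N (Term.var 0)) φ := by
  simpa only [Fm.subst_upSub_shiftSub_inst] using BetaEta.spec (Term.var 0) h

/-! ## Derived equations -/

theorem BetaEta.beta_imp_eq {Γ : List (Fm L)} {M N P : Pf L} {φ ψ : Fm L}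
    (hM : Proves (φ :: Γ) M ψ) (hN : Proves Γ N φ) (h : M.inst N = P) :
    BetaEta Γ (.app (.lam φ M) N) P ψ :=
  h ▸ .beta_imp hM hN

theorem Proves.isubst_upSub_shiftSub {Γ : List (Fm L)} {M : Pf L} {φ : Fm L}
    (h : Proves (Γ.map Fm.shift) M φ) :
    Proves ((Γ.map Fm.shift).map Fm.shift) (M.isubst (upSub shiftSub))
      (φ.subst (upSub shiftSub)) := by
  have := h.isubst (upSub shiftSub)
  rwa [map_shift_map_subst] at this

/-- The `β`-law of `∀` for the generic instance. -/
theorem BetaEta.spec_ishift_gen {Γ : List (Fm L)} {M : Pf L} {φ : Fm L}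
    (h : Proves (Γ.map Fm.shift) M φ) :
    BetaEta (Γ.map Fm.shift) (.spec (Pf.gen M).ishift (Term.var 0)) M φ := by
  have := BetaEta.beta_all (Term.var 0) h.isubst_upSub_shiftSub
  rwa [Pf.isubst_upSub_shiftSub_instSub, Fm.subst_upSub_shiftSub_inst] at this

theorem BetaEta.of_or {Γ : List (Fm L)} {P P' : Pf L} {φ ψ χ : Fm L}
    (hP : Proves [.or φ ψ] P χ) (hP' : Proves [.or φ ψ] P' χ)
    (h₁ : BetaEta (φ :: .or φ ψ :: Γ) (P.instKeep (.inl ψ (.var 0)))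
      (P'.instKeep (.inl ψ (.var 0))) χ)
    (h₂ : BetaEta (ψ :: .or φ ψ :: Γ) (P.instKeep (.inr φ (.var 0)))
      (P'.instKeep (.inr φ (.var 0))) χ) :
    BetaEta (.or φ ψ :: Γ) P P' χ := by
  have hv : Proves (.or φ ψ :: Γ) (.var 0) (.or φ ψ) := .var rfl
  have key := ((BetaEta.eta_or hv (hP.append _)).trans (.caseOf (.refl hv) h₁ h₂)).trans
    (BetaEta.eta_or hv (hP'.append _)).symm
  have hs : ∀ i < [Fm.or φ ψ].length, scons (Pf.var (L := L) 0) Pf.var i = .var i := by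
    intro i hi
    obtain rfl : i = 0 := by simpa using hi
    rfl
  simpa only [Pf.inst, hP.subst_eq_self _ hs, hP'.subst_eq_self _ hs] using key

theorem BetaEta.of_ex {Γ : List (Fm L)} {P P' : Pf L} {φ χ : Fm L}
    (hP : Proves [.ex φ] P χ) (hP' : Proves [.ex φ] P' χ)
    (h : BetaEta (φ :: (Fm.ex φ :: Γ).map Fm.shift)
      (P.ishift.instKeep (.pack (φ.subst (upSub shiftSub)) (Term.var 0) (.var 0)))
      (P'.ishift.instKeep (.pack (φ.subst (upSub shiftSub)) (Term.var 0) (.var 0))) χ.shift) :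
    BetaEta (.ex φ :: Γ) P P' χ := by
  have hv : Proves (.ex φ :: Γ) (.var 0) (.ex φ) := .var rfl
  have key := ((BetaEta.eta_ex hv (hP.append _)).trans (.unpack (.refl hv) h)).trans
    (BetaEta.eta_ex hv (hP'.append _)).symm
  have hs : ∀ i < [Fm.ex φ].length, scons (Pf.var (L := L) 0) Pf.var i = .var i := by
    intro i hi
    obtain rfl : i = 0 := by simpa using hi
    rfl
  simpa only [Pf.inst, hP.subst_eq_self _ hs, hP'.subst_eq_self _ hs] using key

/-- The `β`-law of `∃` for the generic instance. -/
theorem BetaEta.unpack_pack {Γ : List (Fm L)} {M P : Pf L} {φ χ : Fm L}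
    (hP : Proves [φ] P χ.shift) (hM : Proves Γ M φ) :
    BetaEta Γ (.unpack (.pack (φ.subst (upSub shiftSub)) (Term.var 0) M)
      (P.isubst (upSub shiftSub))) (P.inst M) χ.shift := by
  have hP' := hP.isubst (upSub shiftSub)
  rw [Fm.shift_subst_upSub] at hP'
  have := BetaEta.beta_ex (Γ := Γ) (Term.var 0) (by rwa [Fm.subst_upSub_shiftSub_inst])
    (hP'.append (Γ.map Fm.shift))
  rwa [Pf.isubst_upSub_shiftSub_instSub] at this

/-! ## Isomorphisms given by closed terms -/

/-- `N` is a right inverse of `M`, where `M : φ ⇒ ψ` and `N : ψ ⇒ φ` are closed proofs. -/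
structure RightInv (M N : Pf L) (φ ψ : Fm L) : Prop where
  left : Proves [] M (.imp φ ψ)
  right : Proves [] N (.imp ψ φ)
  eq_var : ∀ Γ, BetaEta (ψ :: Γ) (.app M (.app N (.var 0))) (.var 0) ψ

theorem RightInv.eq {M N t : Pf L} {φ ψ : Fm L} (h : RightInv M N φ ψ) {Γ : List (Fm L)}
    (ht : Proves Γ t ψ) : BetaEta Γ (.app M (.app N t)) t ψ := by
  have hb := BetaEta.app (.lam (h.eq_var Γ)) (.refl ht)
  have h₁ : Proves (ψ :: Γ) (.app M (.app N (.var 0))) ψ :=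
    .app h.left.of_closed (.app h.right.of_closed (.var rfl))
  refine (BetaEta.beta_imp_eq h₁ ht ?_).symm.trans (hb.trans (.beta_imp (.var rfl) ht))
  simp only [Pf.inst, Pf.subst, h.left.closed_subst, h.right.closed_subst, scons]

theorem RightInv.of_lam {A B : Pf L} {φ ψ : Fm L} (hA : Proves [φ] A ψ) (hB : Proves [ψ] B φ)
    (h : ∀ Γ, BetaEta (ψ :: Γ) (A.inst B) (.var 0) ψ) :
    RightInv (.lam φ A) (.lam ψ B) φ ψ := by
  refine ⟨.lam hA, .lam hB, fun Γ => .trans (.app (.refl (Proves.lam hA).of_closed)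
    (.beta_imp_eq (hB.append _) (.var rfl) (P := B) ?_)) (.trans ?_ (h Γ))⟩
  · refine hB.subst_eq_self _ fun i hi => ?_
    obtain rfl : i = 0 := by simpa using hi
    rfl
  · exact .beta_imp (hA.append _) (hB.append _)

/-- Isomorphism of formulas by closed proofs, which are inverse to each other in every context. -/
def Equi (φ ψ : Fm L) : Prop :=
  ∃ M N : Pf L, RightInv M N φ ψ ∧ RightInv N M ψ φ

theorem Equi.iso {φ ψ : Fm L} (h : Equi φ ψ) (Γ : List (Fm L)) : Iso Γ φ ψ := by
  obtain ⟨M, N, h₁, h₂⟩ := h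
  refine ⟨M, N, h₁.left.of_closed, h₁.right.of_closed, ?_, ?_⟩ <;>
    simp only [Pf.weaken, h₁.left.closed_rename, h₁.right.closed_rename]
  exacts [.lam (h₁.eq_var Γ), .lam (h₂.eq_var Γ)]

theorem Equi.of_lam {A B : Pf L} {φ ψ : Fm L} (hA : Proves [φ] A ψ) (hB : Proves [ψ] B φ)
    (h₁ : ∀ Γ, BetaEta (ψ :: Γ) (A.inst B) (.var 0) ψ)
    (h₂ : ∀ Γ, BetaEta (φ :: Γ) (B.inst A) (.var 0) φ) : Equi φ ψ :=
  ⟨_, _, .of_lam hA hB h₁, .of_lam hB hA h₂⟩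

theorem Equi.refl (φ : Fm L) : Equi φ φ :=
  .of_lam (A := .var 0) (B := .var 0) (.var rfl) (.var rfl) (fun _ => .refl (.var rfl))
    (fun _ => .refl (.var rfl))

theorem Equi.symm {φ ψ : Fm L} : Equi φ ψ → Equi ψ φ
  | ⟨M, N, h₁, h₂⟩ => ⟨N, M, h₂, h₁⟩

theorem RightInv.trans {M N M' N' : Pf L} {φ ψ χ : Fm L} (h : RightInv M N φ ψ)
    (h' : RightInv M' N' ψ χ) :
    RightInv (.lam φ (.app M' (.app M (.var 0)))) (.lam χ (.app N (.app N' (.var 0)))) φ χ := by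
  refine .of_lam (.app h'.left.of_closed (.app h.left.of_closed (.var rfl)))
    (.app h.right.of_closed (.app h'.right.of_closed (.var rfl))) fun Γ => ?_
  simp only [Pf.inst, Pf.subst, h.left.closed_subst, h'.left.closed_subst, scons]
  exact .trans (.app (.refl h'.left.of_closed) (h.eq (.app h'.right.of_closed (.var rfl))))
    (h'.eq_var Γ)

theorem Equi.trans {φ ψ χ : Fm L} : Equi φ ψ → Equi ψ χ → Equi φ χ
  | ⟨_, _, h₁, h₂⟩, ⟨_, _, h₁', h₂'⟩ => ⟨_, _, h₁.trans h₁', h₂'.trans h₂⟩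

/-! ## Congruence -/

theorem RightInv.and {M N M' N' : Pf L} {φ ψ φ' ψ' : Fm L} (h : RightInv M N φ ψ)
    (h' : RightInv M' N' φ' ψ') :
    RightInv (.lam (.and φ φ') (.pair (.app M (.fst (.var 0))) (.app M' (.snd (.var 0)))))
      (.lam (.and ψ ψ') (.pair (.app N (.fst (.var 0))) (.app N' (.snd (.var 0)))))
      (.and φ φ') (.and ψ ψ') := by
  refine .of_lam
    (.pair (.app h.left.of_closed (.fst (.var rfl))) (.app h'.left.of_closed (.snd (.var rfl))))
    (.pair (.app h.right.of_closed (.fst (.var rfl))) (.app h'.right.of_closed (.snd (.var rfl))))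
    fun Γ => ?_
  simp only [Pf.inst, Pf.subst, h.left.closed_subst, h'.left.closed_subst, scons]
  have hv : Proves (.and ψ ψ' :: Γ) (.var 0) (.and ψ ψ') := .var rfl
  have h₁ : Proves (.and ψ ψ' :: Γ) (.app N (.fst (.var 0))) φ :=
    .app h.right.of_closed (.fst hv)
  have h₂ : Proves (.and ψ ψ' :: Γ) (.app N' (.snd (.var 0))) φ' :=
    .app h'.right.of_closed (.snd hv)
  refine .trans (.pair ?_ ?_) (BetaEta.eta_and hv).symm
  · exact .trans (.app (.refl h.left.of_closed) (.beta_fst h₁ h₂)) (h.eq (.fst hv))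
  · exact .trans (.app (.refl h'.left.of_closed) (.beta_snd h₁ h₂)) (h'.eq (.snd hv))

theorem Equi.and {φ ψ φ' ψ' : Fm L} : Equi φ ψ → Equi φ' ψ' → Equi (.and φ φ') (.and ψ ψ')
  | ⟨_, _, h₁, h₂⟩, ⟨_, _, h₁', h₂'⟩ => ⟨_, _, h₁.and h₁', h₂.and h₂'⟩

theorem RightInv.or {M N M' N' : Pf L} {φ ψ φ' ψ' : Fm L} (h : RightInv M N φ ψ)
    (h' : RightInv M' N' φ' ψ') :
    RightInv
      (.lam (.or φ φ')
        (.caseOf (.var 0) (.inl ψ' (.app M (.var 0))) (.inr ψ (.app M' (.var 0)))))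
      (.lam (.or ψ ψ')
        (.caseOf (.var 0) (.inl φ' (.app N (.var 0))) (.inr φ (.app N' (.var 0)))))
      (.or φ φ') (.or ψ ψ') := by
  have hA₁ {Γ} : Proves (φ :: Γ) (.inl ψ' (.app M (.var 0))) (.or ψ ψ') :=
    .inl (.app h.left.of_closed (.var rfl))
  have hA₂ {Γ} : Proves (φ' :: Γ) (.inr ψ (.app M' (.var 0))) (.or ψ ψ') :=
    .inr (.app h'.left.of_closed (.var rfl))
  have hB₁ {Γ} : Proves (ψ :: Γ) (.inl φ' (.app N (.var 0))) (.or φ φ') :=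
    .inl (.app h.right.of_closed (.var rfl))
  have hB₂ {Γ} : Proves (ψ' :: Γ) (.inr φ (.app N' (.var 0))) (.or φ φ') :=
    .inr (.app h'.right.of_closed (.var rfl))
  refine .of_lam (.caseOf (.var rfl) hA₁ hA₂) (.caseOf (.var rfl) hB₁ hB₂) fun Γ => ?_
  simp only [Pf.inst, Pf.subst, h.left.closed_subst, h'.left.closed_subst, scons, upPf]
  refine .of_or (.caseOf (.caseOf (.var rfl) hB₁ hB₂) hA₁ hA₂) (.var rfl) ?_ ?_ <;>
    simp only [Pf.instKeep, Pf.subst, h.left.closed_subst, h'.left.closed_subst,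
      h.right.closed_subst, h'.right.closed_subst, scons, upPf]
  · refine .trans (.caseOf (.beta_inl (.var rfl) hB₁ hB₂) (.refl hA₁) (.refl hA₂)) ?_
    simp only [Pf.inst, Pf.subst, h.right.closed_subst, scons]
    refine .trans (.beta_inl (.app h.right.of_closed (.var rfl)) hA₁ hA₂) ?_
    simp only [Pf.inst, Pf.subst, h.left.closed_subst, scons]
    exact .inl (h.eq (.var rfl))
  · refine .trans (.caseOf (.beta_inr (.var rfl) hB₁ hB₂) (.refl hA₁) (.refl hA₂)) ?_
    simp only [Pf.inst, Pf.subst, h'.right.closed_subst, scons]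
    refine .trans (.beta_inr (.app h'.right.of_closed (.var rfl)) hA₁ hA₂) ?_
    simp only [Pf.inst, Pf.subst, h'.left.closed_subst, scons]
    exact .inr (h'.eq (.var rfl))

theorem Equi.or {φ ψ φ' ψ' : Fm L} : Equi φ ψ → Equi φ' ψ' → Equi (.or φ φ') (.or ψ ψ')
  | ⟨_, _, h₁, h₂⟩, ⟨_, _, h₁', h₂'⟩ => ⟨_, _, h₁.or h₁', h₂.or h₂'⟩

theorem RightInv.imp {M N M' N' : Pf L} {φ ψ φ' ψ' : Fm L} (h₁ : RightInv M N φ ψ)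
    (h : RightInv N M ψ φ) (h' : RightInv M' N' φ' ψ') :
    RightInv (.lam (.imp φ φ') (.lam ψ (.app M' (.app (.var 1) (.app N (.var 0))))))
      (.lam (.imp ψ ψ') (.lam φ (.app N' (.app (.var 1) (.app M (.var 0))))))
      (.imp φ φ') (.imp ψ ψ') := by
  have hB {Γ : List (Fm L)} {i : ℕ} (hi : Γ[i]? = some (.imp ψ ψ')) :
      Proves (φ :: Γ) (.app N' (.app (.var (i + 1)) (.app M (.var 0)))) φ' :=
    .app h'.right.of_closed (.app (.var hi) (.app h.right.of_closed (.var rfl)))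
  refine .of_lam (.lam (.app h'.left.of_closed (.app (.var rfl)
    (.app h.left.of_closed (.var rfl))))) (.lam (hB rfl)) fun Γ => ?_
  simp only [Pf.inst, Pf.subst, h.left.closed_subst, h'.left.closed_subst, scons, upPf,
    Pf.weaken, Pf.rename, h.right.closed_rename, h'.right.closed_rename, upRen]
  have hx : Proves (ψ :: .imp ψ ψ' :: Γ) (.app N (.var 0)) φ := .app h.left.of_closed (.var rfl)
  refine .trans (.lam (.trans (.app (.refl h'.left.of_closed) (.trans
    (.beta_imp_eq (hB (i := 1) rfl) hx
      (P := .app N' (.app (.var 1) (.app M (.app N (.var 0))))) ?_)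
    (.app (.refl h'.right.of_closed) (.app (.refl (.var rfl)) (h₁.eq (.var rfl))))))
    (h'.eq (.app (.var rfl) (.var rfl))))) (BetaEta.eta_imp (.var rfl)).symm
  simp only [Pf.inst, Pf.subst, h.right.closed_subst, h'.right.closed_subst, scons]

theorem Equi.imp {φ ψ φ' ψ' : Fm L} : Equi φ ψ → Equi φ' ψ' → Equi (.imp φ φ') (.imp ψ ψ')
  | ⟨_, _, h₁, h₂⟩, ⟨_, _, h₁', h₂'⟩ => ⟨_, _, h₁.imp h₂ h₁', h₂.imp h₁ h₂'⟩

theorem RightInv.all {M N : Pf L} {φ ψ : Fm L} (h : RightInv M N φ ψ) :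
    RightInv (.lam (.all φ) (.gen (.app M (.spec (.var 0) (Term.var 0)))))
      (.lam (.all ψ) (.gen (.app N (.spec (.var 0) (Term.var 0))))) (.all φ) (.all ψ) := by
  have hB {Γ : List (Fm L)} :
      Proves ((Fm.all ψ :: Γ).map Fm.shift) (.app N (.spec (.var 0) (Term.var 0))) φ :=
    .app h.right.of_closed (.spec_var (.var rfl))
  refine .of_lam (.gen (.app h.left.of_closed (.spec_var (.var rfl)))) (.gen hB) fun Γ => ?_
  simp only [Pf.inst, Pf.subst, h.left.closed_subst, scons]
  exact .trans (.gen (.trans (.app (.refl h.left.of_closed) (.spec_ishift_gen hB))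
    (h.eq (.spec_var (.var rfl))))) (BetaEta.eta_all (.var rfl)).symm

theorem Equi.all {φ ψ : Fm L} : Equi φ ψ → Equi (.all φ) (.all ψ)
  | ⟨_, _, h₁, h₂⟩ => ⟨_, _, h₁.all, h₂.all⟩

theorem Proves.subst_upPf_eq_self {P : Pf L} {φ χ : Fm L} (h : Proves [φ] P χ)
    (s : ℕ → Pf L) : P.subst (upPf s) = P :=
  h.subst_eq_self _ fun i hi => by
    obtain rfl : i = 0 := by simpa using hi
    rfl

theorem Proves.pack_var {Γ : List (Fm L)} {M : Pf L} {φ : Fm L} (h : Proves Γ M φ) :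
    Proves Γ (.pack (φ.subst (upSub shiftSub)) (Term.var 0) M) (Fm.ex φ).shift :=
  .pack _ (by rwa [Fm.subst_upSub_shiftSub_inst])

theorem BetaEta.pack_var {Γ : List (Fm L)} {M N : Pf L} {φ : Fm L} (h : BetaEta Γ M N φ) :
    BetaEta Γ (.pack (φ.subst (upSub shiftSub)) (Term.var 0) M)
      (.pack (φ.subst (upSub shiftSub)) (Term.var 0) N) (Fm.ex φ).shift :=
  .pack _ (by rwa [Fm.subst_upSub_shiftSub_inst])

theorem RightInv.ex {M N : Pf L} {φ ψ : Fm L} (h : RightInv M N φ ψ) :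
    RightInv
      (.lam (.ex φ) (.unpack (.var 0)
        (.pack (ψ.subst (upSub shiftSub)) (Term.var 0) (.app M (.var 0)))))
      (.lam (.ex ψ) (.unpack (.var 0)
        (.pack (φ.subst (upSub shiftSub)) (Term.var 0) (.app N (.var 0)))))
      (.ex φ) (.ex ψ) := by
  obtain ⟨P, eP⟩ : ∃ P, P = Pf.pack (ψ.subst (upSub shiftSub)) (Term.var 0)
    (.app M (.var 0)) := ⟨_, rfl⟩
  obtain ⟨Q, eQ⟩ : ∃ Q, Q = Pf.pack (φ.subst (upSub shiftSub)) (Term.var 0)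
    (.app N (.var 0)) := ⟨_, rfl⟩
  have hP : Proves [φ] P (Fm.ex ψ).shift := eP ▸ .pack_var (.app h.left.of_closed (.var rfl))
  have hQ : Proves [ψ] Q (Fm.ex φ).shift := eQ ▸ .pack_var (.app h.right.of_closed (.var rfl))
  rw [← eP, ← eQ]
  refine .of_lam (.unpack (.var rfl) (hP.append _)) (.unpack (.var rfl) (hQ.append _))
    fun Γ => ?_
  simp only [Pf.inst, Pf.subst, hP.subst_upPf_eq_self, scons]
  refine .of_ex (.unpack (.unpack (.var rfl) (hQ.append _)) (hP.append _)) (.var rfl) ?_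
  have hP' := hP.isubst (upSub shiftSub)
  have hQ' := hQ.isubst (upSub shiftSub)
  simp only [Pf.ishift, Pf.instKeep, Pf.subst, Pf.isubst, hP'.subst_upPf_eq_self,
    hQ'.subst_upPf_eq_self, scons]
  rw [Fm.shift_subst_upSub] at hP'
  refine .trans (.unpack (.unpack_pack hQ (.var rfl)) (.refl (hP'.append _))) ?_
  rw [eQ]
  simp only [Pf.inst, Pf.subst, h.right.closed_subst, scons]
  refine .trans (.unpack_pack hP (.app h.right.of_closed (.var rfl))) ?_
  rw [eP]
  simp only [Pf.inst, Pf.subst, h.left.closed_subst, scons]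
  exact .pack_var (h.eq (.var rfl))

theorem Equi.ex {φ ψ : Fm L} : Equi φ ψ → Equi (.ex φ) (.ex ψ)
  | ⟨_, _, h₁, h₂⟩ => ⟨_, _, h₁.ex, h₂.ex⟩

/-! ## Basic isomorphisms -/

theorem Equi.top_imp (φ : Fm L) : Equi (.imp .top φ) φ := by
  refine .of_lam (A := .app (.var 0) .star) (B := .lam .top (.var 1))
    (.app (.var rfl) .star) (.lam (.var rfl)) (fun Γ => ?_) (fun Γ => ?_)
  · exact .beta_imp_eq (.var rfl) .star rfl
  · exact .trans (.lam (.app (.refl (.var rfl)) (BetaEta.eta_top (.var rfl)).symm))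
      (BetaEta.eta_imp (.var rfl)).symm

theorem Equi.and_top (φ : Fm L) : Equi (.and φ .top) φ := by
  refine .of_lam (A := .fst (.var 0)) (B := .pair (.var 0) .star)
    (.fst (.var rfl)) (.pair (.var rfl) .star) (fun Γ => ?_) (fun Γ => ?_)
  · exact .beta_fst (.var rfl) .star
  · have hv : Proves (.and φ .top :: Γ) (.var 0) (.and φ .top) := .var rfl
    exact .trans (.pair (.refl (.fst hv)) (BetaEta.eta_top (.snd hv)).symm)
      (BetaEta.eta_and hv).symm

theorem Equi.top_and (φ : Fm L) : Equi (.and .top φ) φ := by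
  refine .of_lam (A := .snd (.var 0)) (B := .pair .star (.var 0))
    (.snd (.var rfl)) (.pair .star (.var rfl)) (fun Γ => ?_) (fun Γ => ?_)
  · exact .beta_snd .star (.var rfl)
  · have hv : Proves (.and .top φ :: Γ) (.var 0) (.and .top φ) := .var rfl
    exact .trans (.pair (BetaEta.eta_top (.fst hv)).symm (.refl (.snd hv)))
      (BetaEta.eta_and hv).symm

theorem Equi.and_assoc (φ ψ χ : Fm L) :
    Equi (.and (.and φ ψ) χ) (.and φ (.and ψ χ)) := by
  have h₁ {Γ : List (Fm L)} {M : Pf L} (h : Proves Γ M (.and (.and φ ψ) χ)) :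
      Proves Γ (.pair (.fst (.fst M)) (.pair (.snd (.fst M)) (.snd M))) (.and φ (.and ψ χ)) :=
    .pair (.fst (.fst h)) (.pair (.snd (.fst h)) (.snd h))
  have h₂ {Γ : List (Fm L)} {M : Pf L} (h : Proves Γ M (.and φ (.and ψ χ))) :
      Proves Γ (.pair (.pair (.fst M) (.fst (.snd M))) (.snd (.snd M))) (.and (.and φ ψ) χ) :=
    .pair (.pair (.fst h) (.fst (.snd h))) (.snd (.snd h))
  refine .of_lam (h₁ (M := .var 0) (.var rfl)) (h₂ (M := .var 0) (.var rfl)) (fun Γ => ?_) (fun Γ => ?_)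
  · have hv : Proves (.and φ (.and ψ χ) :: Γ) (.var 0) (.and φ (.and ψ χ)) := .var rfl
    have e := BetaEta.beta_fst (.pair (.fst hv) (.fst (.snd hv))) (.snd (.snd hv))
    refine .trans (.pair (.trans (.fst e) (.beta_fst (.fst hv) (.fst (.snd hv))))
      (.trans (.pair (.trans (.snd e) (.beta_snd (.fst hv) (.fst (.snd hv))))
        (.beta_snd (.pair (.fst hv) (.fst (.snd hv))) (.snd (.snd hv))))
        (BetaEta.eta_and (.snd hv)).symm)) (BetaEta.eta_and hv).symm
  · have hv : Proves (.and (.and φ ψ) χ :: Γ) (.var 0) (.and (.and φ ψ) χ) := .var rfl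
    have e := BetaEta.beta_snd (.fst (.fst hv)) (.pair (.snd (.fst hv)) (.snd hv))
    refine .trans (.pair (.trans (.pair
      (.beta_fst (.fst (.fst hv)) (.pair (.snd (.fst hv)) (.snd hv)))
      (.trans (.fst e) (.beta_fst (.snd (.fst hv)) (.snd hv))))
        (BetaEta.eta_and (.fst hv)).symm)
      (.trans (.snd e) (.beta_snd (.snd (.fst hv)) (.snd hv)))) (BetaEta.eta_and hv).symm

theorem Equi.imp_top (φ : Fm L) : Equi (.imp φ .top) .top := by
  refine .of_lam (A := .star) (B := .lam φ .star) .star (.lam .star) (fun Γ => ?_) (fun Γ => ?_)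
  · exact (BetaEta.eta_top (.var rfl)).symm
  · exact .trans (.lam (BetaEta.eta_top (.app (.var rfl) (.var rfl))).symm)
      (BetaEta.eta_imp (.var rfl)).symm

theorem Equi.imp_and (φ ψ χ : Fm L) :
    Equi (.imp φ (.and ψ χ)) (.and (.imp φ ψ) (.imp φ χ)) := by
  have hA {Γ : List (Fm L)} {i : ℕ} (hi : Γ[i]? = some (.imp φ (.and ψ χ))) :
      Proves (φ :: Γ) (.app (.var (i + 1)) (.var 0)) (.and ψ χ) := .app (.var hi) (.var rfl)
  have hB {Γ : List (Fm L)} {i : ℕ} (hi : Γ[i]? = some (.and (.imp φ ψ) (.imp φ χ))) :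
      Proves (φ :: Γ) (.app (.fst (.var (i + 1))) (.var 0)) ψ ∧
        Proves (φ :: Γ) (.app (.snd (.var (i + 1))) (.var 0)) χ :=
    ⟨.app (.fst (.var hi)) (.var rfl), .app (.snd (.var hi)) (.var rfl)⟩
  refine .of_lam (.pair (.lam (.fst (hA (i := 0) rfl))) (.lam (.snd (hA (i := 0) rfl))))
    (.lam (.pair (hB (i := 0) rfl).1 (hB (i := 0) rfl).2)) (fun Γ => ?_) (fun Γ => ?_)
  · have hv : Proves (.and (.imp φ ψ) (.imp φ χ) :: Γ) (.var 0)
      (.and (.imp φ ψ) (.imp φ χ)) := .var rfl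
    have h : Proves (φ :: φ :: .and (.imp φ ψ) (.imp φ χ) :: Γ)
      (.pair (.app (.fst (.var 2)) (.var 0)) (.app (.snd (.var 2)) (.var 0))) (.and ψ χ) :=
      .pair (hB (i := 1) rfl).1 (hB (i := 1) rfl).2
    have e := BetaEta.beta_imp h (N := .var 0) (.var rfl)
    refine .trans (.pair (.trans (.lam ?_) (BetaEta.eta_imp (.fst hv)).symm)
      (.trans (.lam ?_) (BetaEta.eta_imp (.snd hv)).symm)) (BetaEta.eta_and hv).symm
    · exact .trans (.fst e) (.beta_fst (hB (i := 0) rfl).1 (hB (i := 0) rfl).2)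
    · exact .trans (.snd e) (.beta_snd (hB (i := 0) rfl).1 (hB (i := 0) rfl).2)
  · have h : Proves (φ :: φ :: .imp φ (.and ψ χ) :: Γ) (.app (.var 2) (.var 0)) (.and ψ χ) :=
      hA (i := 1) rfl
    have h' : Proves (φ :: .imp φ (.and ψ χ) :: Γ) (.app (.var 1) (.var 0)) (.and ψ χ) :=
      hA (i := 0) rfl
    refine .trans (.lam (.trans (.pair ?_ ?_) (BetaEta.eta_and h').symm))
      (BetaEta.eta_imp (.var rfl)).symm
    · exact .trans (.app (.beta_fst (.lam (.fst h)) (.lam (.snd h))) (.refl (.var rfl)))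
        (.beta_imp_eq (.fst h) (.var rfl) rfl)
    · exact .trans (.app (.beta_snd (.lam (.fst h)) (.lam (.snd h))) (.refl (.var rfl)))
        (.beta_imp_eq (.snd h) (.var rfl) rfl)

theorem Equi.curry (φ ψ χ : Fm L) : Equi (.imp φ (.imp ψ χ)) (.imp (.and φ ψ) χ) := by
  have hA {Γ : List (Fm L)} {i : ℕ} (hi : Γ[i]? = some (.imp φ (.imp ψ χ))) :
      Proves (.and φ ψ :: Γ)
        (.app (.app (.var (i + 1)) (.fst (.var 0))) (.snd (.var 0))) χ :=
    .app (.app (.var hi) (.fst (.var rfl))) (.snd (.var rfl))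
  have hB {Γ : List (Fm L)} {i : ℕ} (hi : Γ[i]? = some (.imp (.and φ ψ) χ)) :
      Proves (ψ :: φ :: Γ) (.app (.var (i + 2)) (.pair (.var 1) (.var 0))) χ :=
    .app (.var hi) (.pair (.var rfl) (.var rfl))
  refine .of_lam (.lam (hA (i := 0) rfl)) (.lam (.lam (hB (i := 0) rfl))) (fun Γ => ?_)
    (fun Γ => ?_)
  · have hv : Proves (.and φ ψ :: .imp (.and φ ψ) χ :: Γ) (.var 0) (.and φ ψ) := .var rfl
    refine .trans (.lam ?_) (BetaEta.eta_imp (.var rfl)).symm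
    refine .trans (.app (.beta_imp_eq (.lam (hB (i := 1) rfl)) (.fst hv) rfl)
      (.refl (.snd hv))) ?_
    refine .trans (.beta_imp_eq (.app (.var rfl) (.pair (.fst (.var rfl)) (.var rfl))) (.snd hv)
      rfl) ?_
    exact .app (.refl (.var rfl)) (BetaEta.eta_and hv).symm
  · refine .trans (.lam (.trans (.lam ?_) (BetaEta.eta_imp (.app (.var rfl) (.var rfl))).symm))
      (BetaEta.eta_imp (.var rfl)).symm
    have h₁ : Proves (ψ :: φ :: .imp φ (.imp ψ χ) :: Γ) (.var 1) φ := .var rfl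
    have h₂ : Proves (ψ :: φ :: .imp φ (.imp ψ χ) :: Γ) (.var 0) ψ := .var rfl
    refine .trans (.beta_imp_eq (hA (i := 2) rfl) (.pair h₁ h₂) rfl) ?_
    exact .app (.app (.refl (.var rfl)) (.beta_fst h₁ h₂)) (.beta_snd h₁ h₂)

theorem Equi.all_top : Equi (L := L) (.all .top) .top := by
  refine .of_lam (A := .star) (B := .gen .star) .star (.gen .star) (fun Γ => ?_) (fun Γ => ?_)
  · exact (BetaEta.eta_top (.var rfl)).symm
  · exact .trans (.gen (BetaEta.eta_top (.spec_var (.var rfl))).symm)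
      (BetaEta.eta_all (.var rfl)).symm

theorem Equi.all_and (φ ψ : Fm L) : Equi (.all (.and φ ψ)) (.and (.all φ) (.all ψ)) := by
  have hA {Γ : List (Fm L)} :
      Proves ((Fm.all (.and φ ψ) :: Γ).map Fm.shift) (.spec (.var 0) (Term.var 0)) (.and φ ψ) :=
    .spec_var (.var rfl)
  have hB₁ {Γ : List (Fm L)} :
      Proves ((Fm.and (.all φ) (.all ψ) :: Γ).map Fm.shift)
        (.spec (.fst (.var 0)) (Term.var 0)) φ :=
    .spec_var (.fst (ψ := (Fm.all ψ).shift) (.var rfl))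
  have hB₂ {Γ : List (Fm L)} :
      Proves ((Fm.and (.all φ) (.all ψ) :: Γ).map Fm.shift)
        (.spec (.snd (.var 0)) (Term.var 0)) ψ :=
    .spec_var (.snd (φ := (Fm.all φ).shift) (.var rfl))
  refine .of_lam (.pair (.gen (.fst hA)) (.gen (.snd hA))) (.gen (.pair hB₁ hB₂))
    (fun Γ => ?_) (fun Γ => ?_)
  · have hv : Proves (.and (.all φ) (.all ψ) :: Γ) (.var 0) (.and (.all φ) (.all ψ)) := .var rfl
    have e := BetaEta.spec_ishift_gen (Proves.pair (hB₁ (Γ := Γ)) hB₂)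
    refine .trans (.pair (.trans (.gen ?_) (BetaEta.eta_all (.fst hv)).symm)
      (.trans (.gen ?_) (BetaEta.eta_all (.snd hv)).symm)) (BetaEta.eta_and hv).symm
    · exact .trans (.fst e) (.beta_fst hB₁ hB₂)
    · exact .trans (.snd e) (.beta_snd hB₁ hB₂)
  · have h₁ := Proves.isubst_upSub_shiftSub (Proves.fst (hA (Γ := Γ)))
    have h₂ := Proves.isubst_upSub_shiftSub (Proves.snd (hA (Γ := Γ)))
    refine .trans (.gen (.trans (.pair ?_ ?_) (BetaEta.eta_and hA).symm))
      (BetaEta.eta_all (.var rfl)).symm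
    · exact .trans (.spec_var (.beta_fst (.gen h₁) (.gen h₂))) (.spec_ishift_gen (.fst hA))
    · exact .trans (.spec_var (.beta_snd (.gen h₁) (.gen h₂))) (.spec_ishift_gen (.snd hA))

theorem Equi.imp_all (φ ψ : Fm L) : Equi (.imp φ (.all ψ)) (.all (.imp φ.shift ψ)) := by
  have hA {Γ : List (Fm L)} {i : ℕ}
      (hi : Γ[i]? = some (Fm.imp φ.shift (.all (ψ.subst (upSub shiftSub))))) :
      Proves (φ.shift :: Γ) (.spec (.app (.var (i + 1)) (.var 0)) (Term.var 0)) ψ :=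
    .spec_var (.app (.var hi) (.var rfl))
  have hB {φ ψ : Fm L} {Γ : List (Fm L)} {i : ℕ}
      (hi : Γ[i]? = some (Fm.all (.imp φ.shift ψ))) :
      Proves ((φ :: Γ).map Fm.shift)
        (.app (.spec (.var (i + 1)) (Term.var 0)) (.var 0)) ψ :=
    .app (φ := φ.shift) (.spec_var (φ := .imp φ.shift ψ) (.var (by simp [hi]; rfl))) (.var rfl)
  refine .of_lam (.gen (.lam (hA (i := 0) rfl))) (.lam (.gen (hB (i := 0) rfl)))
    (fun Γ => ?_) (fun Γ => ?_)
  · have hs : Proves ((Fm.all (.imp φ.shift ψ) :: Γ).map Fm.shift)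
      (.spec (.var 0) (Term.var 0)) (.imp φ.shift ψ) := .spec_var (.var rfl)
    refine .trans (.gen (.trans (.lam ?_) (BetaEta.eta_imp hs).symm))
      (BetaEta.eta_all (.var rfl)).symm
    have h : Proves (φ.shift :: φ.shift :: (Fm.all (.imp φ.shift ψ) :: Γ).map Fm.shift)
        (.gen (.app (.spec (.var 2) (Term.var 0)) (.var 0)))
        (.all (ψ.subst (upSub shiftSub))) := by
      refine .gen (hB (i := 1) ?_)
      change some (Fm.all (.imp (φ.shift.subst (upSub shiftSub)) _)) = _
      rw [Fm.shift_subst_upSub]; rfl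
    refine .trans (.spec_var (.beta_imp_eq h (.var rfl) rfl)) ?_
    exact .spec_ishift_gen (Γ := φ :: Fm.all (.imp φ.shift ψ) :: Γ) (hB (i := 0) rfl)
  · have hv : Proves (φ :: .imp φ (.all ψ) :: Γ) (.app (.var 1) (.var 0)) (.all ψ) :=
      .app (.var rfl) (.var rfl)
    refine .trans (.lam (.trans (.gen ?_) (BetaEta.eta_all hv).symm))
      (BetaEta.eta_imp (.var rfl)).symm
    have h : Proves (φ.shift :: (φ :: Fm.imp φ (.all ψ) :: Γ).map Fm.shift)
        (.spec (.app (.var 2) (.var 0)) (Term.var 0)) ψ := hA (i := 1) rfl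
    refine .trans (.app (.spec_ishift_gen (.lam h)) (.refl (.var rfl))) ?_
    exact .beta_imp_eq h (.var rfl) rfl

/-! ## Conjunctions of lists -/

theorem Equi.conj_cons (φ : Fm L) : ∀ l, Equi (conj (φ :: l)) (.and φ (conj l))
  | [] => (Equi.and_top φ).symm
  | _ :: _ => .refl _

theorem Equi.conj_append (l l' : List (Fm L)) :
    Equi (.and (conj l) (conj l')) (conj (l ++ l')) := by
  induction l with
  | nil => exact .top_and _
  | cons φ l ih =>
    exact ((((conj_cons φ l).and (.refl _)).trans (.and_assoc _ _ _)).trans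
      ((Equi.refl φ).and ih)).trans (conj_cons φ _).symm

theorem Equi.all_conj (l : List (Fm L)) : Equi (.all (conj l)) (conj (l.map Fm.all)) := by
  induction l with
  | nil => exact .all_top
  | cons φ l ih =>
    exact (((conj_cons φ l).all.trans (.all_and _ _)).trans ((Equi.refl _).and ih)).trans
      (conj_cons _ _).symm

theorem Equi.imp_conj (φ : Fm L) (l : List (Fm L)) :
    Equi (.imp φ (conj l)) (conj (l.map (Fm.imp φ))) := by
  induction l with
  | nil => exact .imp_top φ
  | cons ψ l ih =>
    exact ((((Equi.refl φ).imp (conj_cons ψ l)).trans (.imp_and _ _ _)).trans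
      ((Equi.refl _).and ih)).trans (conj_cons _ _).symm

theorem Equi.conj_congr {l l' : List (Fm L)} (h : List.Forall₂ Equi l l') :
    Equi (conj l) (conj l') := by
  induction h with
  | nil => exact .refl _
  | cons h _ ih => exact ((conj_cons _ _).trans (h.and ih)).trans (conj_cons _ _).symm

/-! ## The normal forms under substitution -/

theorem conj_subst (σ : ℕ → L.Term ℕ) :
    ∀ l : List (Fm L), (conj l).subst σ = conj (l.map fun φ => φ.subst σ)
  | [] => rfl
  | [_] => rfl
  | φ :: ψ :: l => congrArg (Fm.and (φ.subst σ)) (conj_subst σ (ψ :: l))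

theorem disj_subst (σ : ℕ → L.Term ℕ) :
    ∀ l : List (Fm L), (disj l).subst σ = disj (l.map fun φ => φ.subst σ)
  | [] => rfl
  | [_] => rfl
  | φ :: ψ :: l => congrArg (Fm.or (φ.subst σ)) (disj_subst σ (ψ :: l))

theorem allBlock_subst (φ : Fm L) (k : ℕ) (σ : ℕ → L.Term ℕ) :
    (allBlock k φ).subst σ = allBlock k (φ.subst (upSub^[k] σ)) := by
  induction k generalizing σ with
  | zero => rfl
  | succ k ih => exact congrArg Fm.all (ih _)

/-- Substitution in the factor of a `Π`-formula. -/
def Factor.subst (p : Factor L) (σ : ℕ → L.Term ℕ) : Factor L :=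
  ⟨p.block, p.prem.subst (upSub^[p.block] σ), p.concl.subst (upSub^[p.block] σ)⟩

theorem Factor.toFm_subst (p : Factor L) (σ : ℕ → L.Term ℕ) :
    (p.subst σ).toFm = p.toFm.subst σ :=
  (allBlock_subst (.imp p.prem p.concl) p.block σ).symm

theorem IsPrime.subst {χ : Fm L} (h : IsPrime χ) (σ : ℕ → L.Term ℕ) : IsPrime (χ.subst σ) := by
  cases h with
  | rel R ts => exact .rel R _
  | bot => exact .bot

mutual

theorem IsPi.subst {γ : Fm L} (h : IsPi γ) (σ : ℕ → L.Term ℕ) : IsPi (γ.subst σ) :=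
  match h with
  | .conj l h₁ h₂ => by
    have e : (ExpLog.conj (l.map Factor.toFm)).subst σ =
        ExpLog.conj ((l.map fun p => p.subst σ).map Factor.toFm) := by
      simp only [conj_subst, List.map_map]
      exact congrArg _ (List.map_congr_left fun p _ => (p.toFm_subst σ).symm)
    rw [e]
    refine .conj _ (fun p hp => ?_) (fun p hp => ?_) <;>
      obtain ⟨q, hq, rfl⟩ := List.mem_map.1 hp
    · exact (h₁ q hq).subst _
    · exact (h₂ q hq).subst _

theorem IsSigma.subst {β : Fm L} (h : IsSigma β) (σ : ℕ → L.Term ℕ) : IsSigma (β.subst σ) :=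
  match h with
  | .prime h => .prime (h.subst σ)
  | .disj l hl h => by
    rw [disj_subst]
    refine .disj _ (by simpa only [List.length_map] using hl) fun γ hγ => ?_
    obtain ⟨δ, hδ, rfl⟩ := List.mem_map.1 hγ
    exact (h δ hδ).subst _
  | .ex h => .ex (h.subst _)

end

/-! ## Normalization -/

/-- The factors that occur in `Π`-formulas. -/
def Factor.IsNormal (p : Factor L) : Prop := IsPi p.prem ∧ IsSigma p.concl

theorem isPi_iff {γ : Fm L} :
    IsPi γ ↔ ∃ l : List (Factor L), (∀ p ∈ l, p.IsNormal) ∧ γ = conj (l.map Factor.toFm) := by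
  constructor
  · rintro ⟨l, h₁, h₂⟩
    exact ⟨l, fun p hp => ⟨h₁ p hp, h₂ p hp⟩, rfl⟩
  · rintro ⟨l, h, rfl⟩
    exact .conj l (fun p hp => (h p hp).1) fun p hp => (h p hp).2

theorem exists_isPi_of_forall {l : List (Fm L)}
    (h : ∀ φ ∈ l, ∃ p : Factor L, p.IsNormal ∧ Equi φ p.toFm) :
    ∃ γ, IsPi γ ∧ Equi (conj l) γ := by
  have : Nonempty (Factor L) := ⟨⟨0, .top, .top⟩⟩
  choose! f hf using h
  refine ⟨_, isPi_iff.2 ⟨l.map f, ?_, rfl⟩, Equi.conj_congr ?_⟩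
  · simpa only [List.forall_mem_map] using fun φ hφ => (hf φ hφ).1
  · rw [List.map_map, List.forall₂_map_right_iff, List.forall₂_same]
    exact fun φ hφ => (hf φ hφ).2

theorem IsSigma.exists_isPi {β : Fm L} (h : IsSigma β) : ∃ γ, IsPi γ ∧ Equi β γ :=
  ⟨_, isPi_iff.2 ⟨[⟨0, .top, β⟩], by simpa using ⟨isPi_iff.2 ⟨[], by simp, rfl⟩, h⟩, rfl⟩,
    (Equi.top_imp β).symm⟩

theorem IsPi.exists_and {γ δ : Fm L} (hγ : IsPi γ) (hδ : IsPi δ) :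
    ∃ ε, IsPi ε ∧ Equi (.and γ δ) ε := by
  obtain ⟨l, hl, rfl⟩ := isPi_iff.1 hγ
  obtain ⟨l', hl', rfl⟩ := isPi_iff.1 hδ
  refine ⟨_, isPi_iff.2 ⟨l ++ l', ?_, rfl⟩, ?_⟩
  · exact fun p hp => (List.mem_append.1 hp).elim (hl p) (hl' p)
  · rw [List.map_append]; exact .conj_append _ _

theorem IsPi.exists_all {γ : Fm L} (hγ : IsPi γ) : ∃ δ, IsPi δ ∧ Equi (.all γ) δ := by
  obtain ⟨l, hl, rfl⟩ := isPi_iff.1 hγ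
  have ⟨δ, hδ, e⟩ := exists_isPi_of_forall (l := (l.map Factor.toFm).map Fm.all) (by
    simp only [List.forall_mem_map]
    exact fun p hp => ⟨⟨p.block + 1, p.prem, p.concl⟩, hl p hp, .refl _⟩)
  exact ⟨δ, hδ, (Equi.all_conj _).trans e⟩

theorem IsPi.exists_imp_factor {γ : Fm L} (hγ : IsPi γ) (k : ℕ) {δ β : Fm L} (hδ : IsPi δ)
    (hβ : IsSigma β) :
    ∃ p : Factor L, p.IsNormal ∧ Equi (.imp γ (allBlock k (.imp δ β))) p.toFm := by
  induction k generalizing γ with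
  | zero =>
    obtain ⟨ε, hε, e⟩ := hγ.exists_and hδ
    exact ⟨⟨0, ε, β⟩, ⟨hε, hβ⟩, (Equi.curry _ _ _).trans (e.imp (.refl β))⟩
  | succ k ih =>
    obtain ⟨p, hp, e⟩ := ih (hγ.subst shiftSub)
    exact ⟨⟨p.block + 1, p.prem, p.concl⟩, hp, (Equi.imp_all _ _).trans e.all⟩

theorem IsPi.exists_imp {γ δ : Fm L} (hγ : IsPi γ) (hδ : IsPi δ) :
    ∃ ε, IsPi ε ∧ Equi (.imp γ δ) ε := by
  obtain ⟨l, hl, rfl⟩ := isPi_iff.1 hδ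
  have ⟨ε, hε, e⟩ := exists_isPi_of_forall (l := (l.map Factor.toFm).map (Fm.imp γ)) (by
    simp only [List.forall_mem_map]
    exact fun p hp => hγ.exists_imp_factor p.block (hl p hp).1 (hl p hp).2)
  exact ⟨ε, hε, (Equi.imp_conj _ _).trans e⟩

theorem Fm.exists_isPi (φ : Fm L) : ∃ γ, IsPi γ ∧ Equi φ γ := by
  induction φ with
  | rel R ts => exact (IsSigma.prime (.rel R ts)).exists_isPi
  | bot => exact (IsSigma.prime .bot).exists_isPi
  | top => exact ⟨_, isPi_iff.2 ⟨[], by simp, rfl⟩, .refl _⟩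
  | and φ ψ ih₁ ih₂ =>
    obtain ⟨γ, hγ, e₁⟩ := ih₁
    obtain ⟨δ, hδ, e₂⟩ := ih₂
    obtain ⟨ε, hε, e⟩ := hγ.exists_and hδ
    exact ⟨ε, hε, (e₁.and e₂).trans e⟩
  | or φ ψ ih₁ ih₂ =>
    obtain ⟨γ, hγ, e₁⟩ := ih₁
    obtain ⟨δ, hδ, e₂⟩ := ih₂
    obtain ⟨ε, hε, e⟩ := (IsSigma.disj [γ, δ] le_rfl (by simp [hγ, hδ])).exists_isPi
    exact ⟨ε, hε, (e₁.or e₂).trans e⟩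
  | imp φ ψ ih₁ ih₂ =>
    obtain ⟨γ, hγ, e₁⟩ := ih₁
    obtain ⟨δ, hδ, e₂⟩ := ih₂
    obtain ⟨ε, hε, e⟩ := hγ.exists_imp hδ
    exact ⟨ε, hε, (e₁.imp e₂).trans e⟩
  | all φ ih =>
    obtain ⟨γ, hγ, e₁⟩ := ih
    obtain ⟨ε, hε, e⟩ := hγ.exists_all
    exact ⟨ε, hε, e₁.all.trans e⟩
  | ex φ ih =>
    obtain ⟨γ, hγ, e₁⟩ := ih
    obtain ⟨ε, hε, e⟩ := (IsSigma.ex hγ).exists_isPi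
    exact ⟨ε, hε, e₁.ex.trans e⟩

end ExpLog

theorem mainTheorem4 (L : FirstOrder.Language) :
    ∃ enf : ExpLog.Fm L → ExpLog.Fm L, ∀ φ : ExpLog.Fm L,
      (∀ Γ : List (ExpLog.Fm L), ExpLog.Iso Γ φ (enf φ)) ∧
      (ExpLog.IsPi (enf φ) ∨ ExpLog.IsSigma (enf φ)) := by
  choose enf hPi hEqui using ExpLog.Fm.exists_isPi (L := L)
  exact ⟨enf, fun φ => ⟨(hEqui φ).iso, .inl (hPi φ)⟩⟩
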